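/- The Shannon game $(G,s,t)$ is played on a finite simple graph $G$ with two distinct vertices $s,t$, called terminals. Two players, Short and Cut, alternately take a non-terminal vertex that has not been taken yet, until no such vertex is left. Short wins if $G$ then has a path from $s$ to $t$ all of whose inner vertices were taken by Short; otherwise Cut wins. The game $(G,s,t)$ is a strong link if Short has a winning strategy as second player, and a weak link if each of the two players has a winning strategy when moving first. A weak link is minimal if the deletion of any single edge of $G$ weakens it, that is, yields a game that is neither a weak nor a strong link. The weight $w$ is the number of non-terminal vertices of $G$, the centre is the set of vertices that are neither terminals nor adjacent to a terminal, $p$ is the size of the centre, and $d_s,d_t$ are the degrees of $s,t$ in $G$. Theorem. For every minimal weak link of weight $w$: \[ w>3 \;\Rightarrow\; p\ge 1, \qquad\qquad w>5 \;\Rightarrow\; p\ge 2, \] and if $w\le 7$, then \[ d_s+d_t\le \frac{w+3}{2}. \] -/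

import Mathlib

namespace ShannonGame

variable {V : Type*}

/-- The two players: Short tries to join the terminals, Cut tries to separate them. -/
inductive Player
  | short
  | cut

/-- A vertex that can still be played when `S` is the set of vertices taken by Short and `C` the
set of vertices taken by Cut: a non-terminal vertex that neither player has taken. -/
def Free (s t : V) (S C : Set V) (v : V) : Prop :=
  v ≠ s ∧ v ≠ t ∧ v ∉ S ∧ v ∉ C

/-- The vertices in `S`, together with the terminals, contain a path from `s` to `t`. -/
def Joined (G : SimpleGraph V) (s t : V) (S : Set V) : Prop :=
  ∃ W : G.Walk s t, ∀ v ∈ W.support, v = s ∨ v = t ∨ v ∈ S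

/-- `ShortWins G s t m S C`: Short has a winning strategy in the Shannon game `(G, s, t)` from the
position in which Short has taken `S`, Cut has taken `C`, and player `m` is to move. The players
alternately take a free vertex until none is left; then Short has won if and only if the terminals
are joined through Short's vertices. -/
inductive ShortWins (G : SimpleGraph V) (s t : V) : Player → Set V → Set V → Prop
  | finished (m : Player) (S C : Set V) (hfull : ∀ v, ¬ Free s t S C v)
      (hwin : Joined G s t S) : ShortWins G s t m S C
  | move (S C : Set V) (v : V) (hv : Free s t S C v)
      (h : ShortWins G s t Player.cut (insert v S) C) : ShortWins G s t Player.short S C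
  | reply (S C : Set V) (hne : ∃ v, Free s t S C v)
      (h : ∀ v, Free s t S C v → ShortWins G s t Player.short S (insert v C)) :
      ShortWins G s t Player.cut S C

/-- `CutWins G s t m S C`: Cut has a winning strategy in the Shannon game `(G, s, t)` from the
position in which Short has taken `S`, Cut has taken `C`, and player `m` is to move. -/
inductive CutWins (G : SimpleGraph V) (s t : V) : Player → Set V → Set V → Prop
  | finished (m : Player) (S C : Set V) (hfull : ∀ v, ¬ Free s t S C v)
      (hwin : ¬ Joined G s t S) : CutWins G s t m S C
  | move (S C : Set V) (v : V) (hv : Free s t S C v)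
      (h : CutWins G s t Player.short S (insert v C)) : CutWins G s t Player.cut S C
  | reply (S C : Set V) (hne : ∃ v, Free s t S C v)
      (h : ∀ v, Free s t S C v → CutWins G s t Player.cut (insert v S) C) :
      CutWins G s t Player.short S C

/-- Strong link: Short has a second-player winning strategy. -/
def IsStrongLink (G : SimpleGraph V) (s t : V) : Prop :=
  ShortWins G s t Player.cut ∅ ∅

/-- Weak link: both players have a first-player winning strategy. -/
def IsWeakLink (G : SimpleGraph V) (s t : V) : Prop :=
  ShortWins G s t Player.short ∅ ∅ ∧ CutWins G s t Player.cut ∅ ∅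

/-- Minimal weak link: a weak link that the deletion of any single edge weakens, so that it is no
longer a link, neither a weak nor a strong one. -/
def IsMinimalWeakLink (G : SimpleGraph V) (s t : V) : Prop :=
  IsWeakLink G s t ∧
    ∀ e ∈ G.edgeSet, ¬ IsWeakLink (G.deleteEdges {e}) s t ∧ ¬ IsStrongLink (G.deleteEdges {e}) s t

/-- The weight: the number of vertices other than the terminals. -/
noncomputable def weight (s t : V) : ℕ :=
  {v : V | v ≠ s ∧ v ≠ t}.ncard

/-- The centre: the vertices that are neither terminals nor neighbours of a terminal. -/
def centre (G : SimpleGraph V) (s t : V) : Set V :=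
  {v | v ≠ s ∧ v ≠ t ∧ ¬ G.Adj s v ∧ ¬ G.Adj t v}

end ShannonGame

namespace ShannonGame

/-! ### Monotonicity, symmetry and threats in the game -/

variable {V : Type*} {G H : SimpleGraph V} {s t : V} {S C : Set V}

/-! Cut's win as first player survives deletion of edges, so in a minimal weak link Short wins
moving first but on no proper subgraph (`IsShortCritical`). Hence, as soon as Short wins on a small
subgraph, that subgraph is all of `G`: its vertices cover every edge, and every other vertex is
isolated and so central.

A common neighbour of the terminals is a winning subgraph of one vertex. Otherwise consider the
bridges, the edges between the two neighbourhoods. Two bridges at one vertex give a winning subgraph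
on three vertices. If the bridges form a matching instead, Cut pairs their ends
(`not_shortWins_of_pairing`). With empty centre every joining path uses a bridge, so Cut wins, which
is absurd; hence `w ≤ 3`. With a single central vertex `c`, the failure of this pairing, and of its
extensions by a pair containing `c`, exhibits a winning subgraph on five vertices including `c`;
hence `w ≤ 5`.

Without a common neighbour `d_s + d_t = w - p`, so the degree bound says `w ≤ 2p + 3`: the two
bounds above for `p ≤ 1`, and `w ≤ 7` for larger `p`. -/

lemma Joined.mono_graph (h : H ≤ G) (hJ : Joined H s t S) : Joined G s t S := by
  obtain ⟨W, hW⟩ := hJ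
  exact ⟨W.mapLe h, by simpa using hW⟩

lemma Joined.symm (hJ : Joined G s t S) : Joined G t s S := by
  obtain ⟨W, hW⟩ := hJ
  refine ⟨W.reverse, fun v hv => ?_⟩
  have := hW v (by simpa using hv)
  tauto

lemma joined_of_adj (h : G.Adj s t) : Joined G s t S :=
  ⟨.cons h .nil, by simp⟩

lemma joined_of_mem {a : V} (hsa : G.Adj s a) (hat : G.Adj a t) (ha : a ∈ S) :
    Joined G s t S :=
  ⟨.cons hsa (.cons hat .nil), by simp [ha]⟩

lemma joined_of_mem_mem {a b : V} (hsa : G.Adj s a) (hab : G.Adj a b) (hbt : G.Adj b t)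
    (ha : a ∈ S) (hb : b ∈ S) : Joined G s t S :=
  ⟨.cons hsa (.cons hab (.cons hbt .nil)), by simp [ha, hb]⟩

lemma joined_of_mem_mem_mem {a c b : V} (hsa : G.Adj s a) (hac : G.Adj a c) (hcb : G.Adj c b)
    (hbt : G.Adj b t) (ha : a ∈ S) (hc : c ∈ S) (hb : b ∈ S) : Joined G s t S :=
  ⟨.cons hsa (.cons hac (.cons hcb (.cons hbt .nil))), by simp [ha, hb, hc]⟩

lemma ShortWins.mono_graph {m : Player} (h : H ≤ G) (hw : ShortWins H s t m S C) :
    ShortWins G s t m S C := by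
  induction hw with
  | finished m S C hfull hwin => exact .finished m S C hfull (hwin.mono_graph h)
  | move S C v hv _ ih => exact .move S C v hv ih
  | reply S C hne _ ih => exact .reply S C hne ih

lemma CutWins.anti_graph {m : Player} (h : H ≤ G) (hw : CutWins G s t m S C) :
    CutWins H s t m S C := by
  induction hw with
  | finished m S C hfull hwin => exact .finished m S C hfull fun hJ => hwin (hJ.mono_graph h)
  | move S C v hv _ ih => exact .move S C v hv ih
  | reply S C hne _ ih => exact .reply S C hne ih

lemma Free.symm {v : V} (h : Free s t S C v) : Free t s S C v :=
  ⟨h.2.1, h.1, h.2.2⟩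

lemma ShortWins.symm {m : Player} (hw : ShortWins G s t m S C) : ShortWins G t s m S C := by
  induction hw with
  | finished m S C hfull hwin => exact .finished m S C (fun v hv => hfull v hv.symm) hwin.symm
  | move S C v hv _ ih => exact .move S C v hv.symm ih
  | reply S C hne _ ih =>
    exact .reply S C (hne.imp fun _ hv => hv.symm) fun v hv => ih v hv.symm

lemma CutWins.not_adj {m : Player} (hw : CutWins G s t m S C) : ¬ G.Adj s t := by
  intro hadj
  induction hw with
  | finished m S C hfull hwin => exact hwin (joined_of_adj hadj)
  | move S C v hv _ ih => exact ih
  | reply S C hne _ ih => exact hne.elim ih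

lemma Joined.mono {S' : Set V} (hS : S ⊆ S') (hJ : Joined G s t S) : Joined G s t S' := by
  obtain ⟨W, hW⟩ := hJ
  exact ⟨W, fun v hv => (hW v hv).imp_right (Or.imp_right fun h => hS h)⟩

/-- Once the terminals are joined, Short has won, whoever is to move. -/
lemma Joined.shortWins [Finite V] (hJ : Joined G s t S) (m : Player) : ShortWins G s t m S C := by
  induction hn : {v | Free s t S C v}.ncard using Nat.strong_induction_on generalizing m S C with
  | _ n ih =>
    subst hn
    by_cases hfull : ∀ v, ¬ Free s t S C v
    · exact .finished m S C hfull hJ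
    push Not at hfull
    cases m with
    | short =>
      obtain ⟨v, hv⟩ := hfull
      refine .move S C v hv (ih _ ?_ (hJ.mono (Set.subset_insert v S)) _ rfl)
      refine Set.ncard_lt_ncard ⟨fun x hx => ?_, fun h => ?_⟩
      · exact ⟨hx.1, hx.2.1, fun h => hx.2.2.1 (Set.mem_insert_of_mem v h), hx.2.2.2⟩
      · exact (h hv).2.2.1 (Set.mem_insert v S)
    | cut =>
      refine .reply S C hfull fun v hv => ih _ ?_ hJ _ rfl
      refine Set.ncard_lt_ncard ⟨fun x hx => ?_, fun h => ?_⟩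
      · exact ⟨hx.1, hx.2.1, hx.2.2.1, fun h => hx.2.2.2 (Set.mem_insert_of_mem v h)⟩
      · exact (h hv).2.2.2 (Set.mem_insert v C)

lemma shortWins_short_of_threat [Finite V] {x : V} (hx : Free s t S C x)
    (hJ : Joined G s t (insert x S)) : ShortWins G s t .short S C :=
  .move S C x hx (hJ.shortWins _)

lemma Free.insert_cut {x v : V} (hx : Free s t S C x) (h : x ≠ v) :
    Free s t S (insert v C) x :=
  ⟨hx.1, hx.2.1, hx.2.2.1, by simp [h, hx.2.2.2]⟩

lemma Free.insert_short {x v : V} (hx : Free s t S C x) (h : x ≠ v) :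
    Free s t (insert v S) C x :=
  ⟨hx.1, hx.2.1, by simp [h, hx.2.2.1], hx.2.2.2⟩

/-- Two simultaneous threats win for Short. -/
lemma shortWins_cut_of_two_threats [Finite V] {x y : V} (hx : Free s t S C x)
    (hy : Free s t S C y) (hxy : x ≠ y) (hJx : Joined G s t (insert x S))
    (hJy : Joined G s t (insert y S)) : ShortWins G s t .cut S C := by
  refine .reply S C ⟨x, hx⟩ fun v _ => ?_
  by_cases hv : x = v
  · subst hv
    exact shortWins_short_of_threat (hy.insert_cut hxy.symm) hJy
  · exact shortWins_short_of_threat (hx.insert_cut hv) hJx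

/-- If Short has a threat that wins for him unless Cut answers it, Cut has to answer it. -/
lemma shortWins_cut_of_threat [Finite V] {x : V} (hx : Free s t S C x)
    (hJx : Joined G s t (insert x S)) (h : ShortWins G s t .short S (insert x C)) :
    ShortWins G s t .cut S C := by
  refine .reply S C ⟨x, hx⟩ fun v _ => ?_
  by_cases hv : x = v
  · exact hv ▸ h
  · exact shortWins_short_of_threat (hx.insert_cut hv) hJx

lemma free_empty {v : V} (hs : v ≠ s) (ht : v ≠ t) : Free s t ∅ ∅ v :=
  ⟨hs, ht, Set.notMem_empty v, Set.notMem_empty v⟩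

/-! ### Small configurations in which Short wins moving first -/

section Patterns

variable [Finite V]

lemma shortWins_of_common_neighbor {v : V} (hsv : G.Adj s v) (hvt : G.Adj v t) :
    ShortWins G s t .short ∅ ∅ :=
  shortWins_short_of_threat (free_empty hsv.ne' hvt.ne)
    (joined_of_mem hsv hvt (Set.mem_insert v ∅))

variable {a a' b b' c : V}

/-- Taking `a` threatens both `b` and `b'`. -/
lemma shortWins_of_cherry (hst : ¬ G.Adj s t) (hsa : G.Adj s a) (hab : G.Adj a b)
    (hab' : G.Adj a b') (hbt : G.Adj b t) (hbt' : G.Adj b' t) (hbs : b ≠ s) (hbs' : b' ≠ s)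
    (hbb : b ≠ b') : ShortWins G s t .short ∅ ∅ := by
  have hat : a ≠ t := fun h => hst (h ▸ hsa)
  refine .move _ _ a (free_empty hsa.ne' hat) ?_
  exact shortWins_cut_of_two_threats ((free_empty hbs hbt.ne).insert_short hab.ne')
    ((free_empty hbs' hbt'.ne).insert_short hab'.ne') hbb
    (joined_of_mem_mem hsa hab hbt (by simp) (by simp))
    (joined_of_mem_mem hsa hab' hbt' (by simp) (by simp))

/-- Short takes `c`. Cut's reply spoils at most one of the two sides; Short takes a remaining vertex
on the spoiled side and then has two threats on the intact one. -/
lemma shortWins_of_double_fan (hst : ¬ G.Adj s t) (hsa : G.Adj s a) (hsa' : G.Adj s a')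
    (hac : G.Adj a c) (hac' : G.Adj a' c) (hcb : G.Adj c b) (hcb' : G.Adj c b')
    (hbt : G.Adj b t) (hbt' : G.Adj b' t) (hcs : c ≠ s) (hct : c ≠ t) (haa : a ≠ a')
    (hbb : b ≠ b') (hdisj : ∀ v, G.Adj s v → ¬ G.Adj v t) : ShortWins G s t .short ∅ ∅ := by
  have hA : ∀ v, G.Adj s v → Free s t ∅ ∅ v := fun v hv =>
    free_empty hv.ne' fun h => hst (h ▸ hv)
  have hB : ∀ v, G.Adj v t → Free s t ∅ ∅ v := fun v hv =>
    free_empty (fun h => hst (h ▸ hv)) hv.ne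
  have hAB : ∀ x y, G.Adj s x → G.Adj y t → x ≠ y := fun x y hx hy h => hdisj x hx (h ▸ hy)
  have key_left : ∀ x y, G.Adj s x → G.Adj x c → x ≠ y → (y ≠ b ∧ y ≠ b') →
      ShortWins G s t .short (insert c ∅) (insert y ∅) := by
    intro x y hx hxc hxy ⟨hyb, hyb'⟩
    refine .move _ _ x (((hA x hx).insert_cut hxy).insert_short hxc.ne) ?_
    exact shortWins_cut_of_two_threats
      ((((hB b hbt).insert_cut hyb.symm).insert_short hcb.ne').insert_short (hAB x b hx hbt).symm)
      ((((hB b' hbt').insert_cut hyb'.symm).insert_short hcb'.ne').insert_short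
        (hAB x b' hx hbt').symm) hbb
      (joined_of_mem_mem_mem hx hxc hcb hbt (by simp) (by simp) (by simp))
      (joined_of_mem_mem_mem hx hxc hcb' hbt' (by simp) (by simp) (by simp))
  have key_right : ∀ x y, G.Adj x t → G.Adj c x → x ≠ y → (y ≠ a ∧ y ≠ a') →
      ShortWins G s t .short (insert c ∅) (insert y ∅) := by
    intro x y hx hcx hxy ⟨hya, hya'⟩
    refine .move _ _ x (((hB x hx).insert_cut hxy).insert_short hcx.ne') ?_
    exact shortWins_cut_of_two_threats
      ((((hA a hsa).insert_cut hya.symm).insert_short hac.ne).insert_short (hAB a x hsa hx))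
      ((((hA a' hsa').insert_cut hya'.symm).insert_short hac'.ne).insert_short (hAB a' x hsa' hx))
      haa
      (joined_of_mem_mem_mem hsa hac hcx hx (by simp) (by simp) (by simp))
      (joined_of_mem_mem_mem hsa' hac' hcx hx (by simp) (by simp) (by simp))
  refine .move _ _ c (free_empty hcs hct) ?_
  refine .reply _ _ ⟨a, (hA a hsa).insert_short hac.ne⟩ fun y _ => ?_
  by_cases hya : y = a
  · subst hya
    exact key_left a' y hsa' hac' haa.symm ⟨hAB y b hsa hbt, hAB y b' hsa hbt'⟩
  by_cases hya' : y = a'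
  · subst hya'
    exact key_left a y hsa hac haa ⟨hAB y b hsa' hbt, hAB y b' hsa' hbt'⟩
  by_cases hyb : y = b
  · subst hyb
    exact key_right b' y hbt' hcb' hbb.symm ⟨hya, hya'⟩
  · exact key_right b y hbt hcb (Ne.symm hyb) ⟨hya, hya'⟩

/-- Taking `a` forces Cut to take `b`; then taking `c` threatens both `b'` and `b''`. -/
lemma shortWins_of_forced_fan {b'' : V} (hst : ¬ G.Adj s t) (hsa : G.Adj s a) (hab : G.Adj a b)
    (hbt : G.Adj b t) (hac : G.Adj a c) (hcb' : G.Adj c b') (hcb'' : G.Adj c b'')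
    (hbt' : G.Adj b' t) (hbt'' : G.Adj b'' t) (hcs : c ≠ s) (hct : c ≠ t) (hcb : c ≠ b)
    (hbb' : b ≠ b') (hbb'' : b ≠ b'') (hb : b' ≠ b'')
    (hdisj : ∀ v, G.Adj s v → ¬ G.Adj v t) : ShortWins G s t .short ∅ ∅ := by
  have hB : ∀ v, G.Adj v t → Free s t ∅ ∅ v := fun v hv =>
    free_empty (fun h => hst (h ▸ hv)) hv.ne
  have hBa : ∀ v, G.Adj v t → v ≠ a := fun v hv h => hdisj a hsa (h ▸ hv)
  refine .move _ _ a (free_empty hsa.ne' fun h => hst (h ▸ hsa)) ?_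
  refine shortWins_cut_of_threat ((hB b hbt).insert_short hab.ne')
    (joined_of_mem_mem hsa hab hbt (by simp) (by simp)) ?_
  refine .move _ _ c (((free_empty hcs hct).insert_short hac.ne').insert_cut hcb) ?_
  exact shortWins_cut_of_two_threats
    ((((hB b' hbt').insert_short (hBa b' hbt')).insert_cut hbb'.symm).insert_short hcb'.ne')
    ((((hB b'' hbt'').insert_short (hBa b'' hbt'')).insert_cut hbb''.symm).insert_short hcb''.ne')
    hb
    (joined_of_mem_mem_mem hsa hac hcb' hbt' (by simp) (by simp) (by simp))
    (joined_of_mem_mem_mem hsa hac hcb'' hbt'' (by simp) (by simp) (by simp))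

/-- Taking `a` forces Cut to take `b`; then taking `b'` threatens both `c` and `a'`. -/
lemma shortWins_of_forced_pair (hst : ¬ G.Adj s t) (hsa : G.Adj s a) (hsa' : G.Adj s a')
    (hab : G.Adj a b) (hab' : G.Adj a' b') (hbt : G.Adj b t) (hbt' : G.Adj b' t)
    (hac : G.Adj a c) (hcb' : G.Adj c b') (hcs : c ≠ s) (hct : c ≠ t) (hcb : c ≠ b)
    (hca' : c ≠ a') (haa : a ≠ a') (hbb : b ≠ b')
    (hdisj : ∀ v, G.Adj s v → ¬ G.Adj v t) : ShortWins G s t .short ∅ ∅ := by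
  have hA : ∀ v, G.Adj s v → Free s t ∅ ∅ v := fun v hv =>
    free_empty hv.ne' fun h => hst (h ▸ hv)
  have hB : ∀ v, G.Adj v t → Free s t ∅ ∅ v := fun v hv =>
    free_empty (fun h => hst (h ▸ hv)) hv.ne
  have hAB : ∀ x y, G.Adj s x → G.Adj y t → x ≠ y := fun x y hx hy h => hdisj x hx (h ▸ hy)
  refine .move _ _ a (hA a hsa) ?_
  refine shortWins_cut_of_threat ((hB b hbt).insert_short hab.ne')
    (joined_of_mem_mem hsa hab hbt (by simp) (by simp)) ?_
  refine .move _ _ b'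
    (((hB b' hbt').insert_short (hAB a b' hsa hbt').symm).insert_cut hbb.symm) ?_
  exact shortWins_cut_of_two_threats
    ((((free_empty hcs hct).insert_short hac.ne').insert_cut hcb).insert_short hcb'.ne)
    ((((hA a' hsa').insert_short haa.symm).insert_cut (hAB a' b hsa' hbt)).insert_short
      hab'.ne) hca'
    (joined_of_mem_mem_mem hsa hac hcb' hbt' (by simp) (by simp) (by simp))
    (joined_of_mem_mem hsa' hab' hbt' (by simp) (by simp))

end Patterns

/-! ### Cut's pairing strategy -/

/-- Pairing strategy for Cut: if disjoint pairs of non-terminal vertices are such that Short can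
only join the terminals by taking both vertices of a pair, then Short does not win, even as first
player. -/
lemma not_shortWins_of_pairing {R : V → V → Prop} (hsymm : ∀ u v, R u v → R v u)
    (hirr : ∀ u, ¬ R u u) (hfun : ∀ u v w, R u v → R u w → v = w)
    (hs : ∀ u v, R u v → v ≠ s) (ht : ∀ u v, R u v → v ≠ t)
    (hJ : ∀ S, Joined G s t S → ∃ u ∈ S, ∃ v ∈ S, R u v) :
    ¬ ShortWins G s t .short ∅ ∅ := by
  -- Invariant: Cut holds the partner of each vertex of Short, except possibly, when Cut is to move,
  -- that of Short's last vertex `x`.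
  have key : ∀ m S C, ShortWins G s t m S C → Disjoint S C →
      match m with
      | .short => ¬ ∀ u ∈ S, ∀ v, R u v → v ∈ C
      | .cut => ¬ ∃ x, ∀ u ∈ S, u ≠ x → ∀ v, R u v → v ∈ C := by
    intro m S C hw
    induction hw with
    | finished m S C hfull hwin =>
      intro hd
      rw [Set.disjoint_left] at hd
      obtain ⟨u, hu, v, hv, huv⟩ := hJ S hwin
      cases m with
      | short => exact fun h => hd hv (h u hu v huv)
      | cut =>
        rintro ⟨x, hx⟩
        by_cases hux : u = x
        · refine hd hu (hx v hv ?_ u (hsymm _ _ huv))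
          rintro rfl
          exact hirr _ (hux ▸ huv)
        · exact hd hv (hx u hu hux v huv)
    | move S C v hv _ ih =>
      intro hd h
      refine ih ?_ ⟨v, fun u hu huv => h u (hu.resolve_left huv)⟩
      rw [Set.disjoint_insert_left]
      exact ⟨hv.2.2.2, hd⟩
    | reply S C hne _ ih =>
      rintro hd ⟨x, hx⟩
      have hdis : ∀ y, Free s t S C y → Disjoint S (insert y C) := fun y hy => by
        rw [Set.disjoint_insert_right]
        exact ⟨hy.2.2.1, hd⟩
      by_cases hfree : ∃ y, R x y ∧ Free s t S C y
      · obtain ⟨y, hxy, hy⟩ := hfree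
        refine ih y hy (hdis y hy) fun u hu v huv => ?_
        by_cases hux : u = x
        · subst hux
          exact Or.inl (hfun _ _ _ huv hxy)
        · exact Or.inr (hx u hu hux v huv)
      -- Nothing to answer: if `x` has a partner, Cut already holds it, so any move keeps the
      -- invariant.
      · obtain ⟨y, hy⟩ := hne
        refine ih y hy (hdis y hy) fun u hu v huv => Or.inr ?_
        by_cases hux : u = x
        · subst hux
          by_contra hvC
          refine hfree ⟨v, huv, hs u v huv, ht u v huv, fun hvS => ?_, hvC⟩
          refine Set.disjoint_left.mp hd hu (hx v hvS ?_ u (hsymm _ _ huv))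
          rintro rfl
          exact hirr _ huv
        · exact hx u hu hux v huv
  exact fun hw => key _ _ _ hw (by simp) (by simp)

/-! ### Critical graphs, short paths and bridges -/

/-- The subgraph of the edges of `G` with both ends in `X`. -/
def restrict (G : SimpleGraph V) (X : Set V) : SimpleGraph V where
  Adj u v := G.Adj u v ∧ u ∈ X ∧ v ∈ X
  symm := ⟨fun _ _ h => ⟨h.1.symm, h.2.2, h.2.1⟩⟩
  loopless := ⟨fun _ h => h.1.ne rfl⟩

lemma restrict_le (X : Set V) : restrict G X ≤ G := fun _ _ h => h.1

/-- Short wins as first player on `G`, but on no proper subgraph, and the terminals are not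
adjacent. -/
structure IsShortCritical (G : SimpleGraph V) (s t : V) : Prop where
  not_adj : ¬ G.Adj s t
  wins : ShortWins G s t .short ∅ ∅
  eq_of_le : ∀ H ≤ G, ShortWins H s t .short ∅ ∅ → H = G

/-- A proper subgraph misses some edge `e`. Cut still wins first after deleting `e`, so by
minimality Short no longer does, and even less on the subgraph. -/
lemma IsMinimalWeakLink.isShortCritical (h : IsMinimalWeakLink G s t) :
    IsShortCritical G s t where
  not_adj := h.1.2.not_adj
  wins := h.1.1
  eq_of_le H hle hw := by
    by_contra hne
    obtain ⟨e, heG, heH⟩ : ∃ e ∈ G.edgeSet, e ∉ H.edgeSet := by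
      by_contra! hcon
      exact hne (le_antisymm hle (SimpleGraph.edgeSet_subset_edgeSet.mp hcon))
    refine (h.2 e heG).1 ⟨hw.mono_graph ?_, h.1.2.anti_graph (G.deleteEdges_le _)⟩
    intro u v huv
    rw [SimpleGraph.deleteEdges_adj]
    refine ⟨hle huv, fun he => heH ?_⟩
    rw [Set.mem_singleton_iff] at he
    exact he ▸ huv

lemma IsShortCritical.symm (h : IsShortCritical G s t) : IsShortCritical G t s where
  not_adj h' := h.not_adj h'.symm
  wins := h.wins.symm
  eq_of_le H hle hw := h.eq_of_le H hle hw.symm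

/-- Every edge has its ends among the terminals and the vertices of `K`. -/
def Covers (G : SimpleGraph V) (s t : V) (K : Finset V) : Prop :=
  ∀ u v, G.Adj u v → u ∈ K ∨ u = s ∨ u = t

lemma Covers.symm {K : Finset V} (h : Covers G s t K) : Covers G t s K :=
  fun u v huv => (h u v huv).imp_right Or.symm

lemma IsShortCritical.covers (h : IsShortCritical G s t) {K : Finset V}
    (hw : ShortWins (restrict G {v | v ∈ K ∨ v = s ∨ v = t}) s t .short ∅ ∅) :
    Covers G s t K := by
  intro u v huv
  rw [← h.eq_of_le _ (restrict_le _) hw] at huv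
  exact huv.2.1

/-- A path from `s` to `t` through at most one central vertex contains a path with one of two
shapes. -/
lemma Joined.exists_short_path {c : V} (hst : s ≠ t) (hadj : ¬ G.Adj s t)
    (hdisj : ∀ v, G.Adj s v → ¬ G.Adj v t) (hcen : centre G s t ⊆ {c}) (hJ : Joined G s t S) :
    (∃ a ∈ S, ∃ b ∈ S, G.Adj s a ∧ G.Adj a b ∧ G.Adj b t) ∨
      ∃ a ∈ S, ∃ b ∈ S, c ∈ centre G s t ∧ c ∈ S ∧
        G.Adj s a ∧ G.Adj a c ∧ G.Adj c b ∧ G.Adj b t := by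
  obtain ⟨W, hW⟩ := hJ
  by_contra! hcon
  obtain ⟨hno, hno'⟩ := hcon
  -- If neither shape occurs, the vertices reachable from `s` through `S` stay inside `X`, which
  -- does not contain `t`.
  let X : Set V := {v | v = s ∨ (v ∈ S ∧ G.Adj s v) ∨
    (v = c ∧ c ∈ centre G s t ∧ c ∈ S ∧ ∃ a ∈ S, G.Adj s a ∧ G.Adj a c)}
  have hclosed : ∀ u ∈ X, ∀ v, G.Adj u v → (v = s ∨ v = t ∨ v ∈ S) → v ∈ X := by
    intro u hu v huv hv
    by_cases hvs : v = s
    · exact Or.inl hvs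
    by_cases hvA : G.Adj s v
    · rcases hv with hv | hv | hv
      · exact Or.inl hv
      · exact absurd (hv ▸ hvA) hadj
      · exact Or.inr (Or.inl ⟨hv, hvA⟩)
    rcases hu with rfl | ⟨huS, hu⟩ | ⟨rfl, hc, hcS, a, haS, hsa, hac⟩
    · exact absurd huv hvA
    · have hvt : v ≠ t := fun h => hdisj u hu (h ▸ huv)
      have hvS : v ∈ S := (hv.resolve_left hvs).resolve_left hvt
      have hvB : ¬ G.Adj v t := hno u huS v hvS hu huv
      have hvc : v ∈ centre G s t := ⟨hvs, hvt, hvA, fun h => hvB h.symm⟩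
      obtain rfl : v = c := hcen hvc
      exact Or.inr (Or.inr ⟨rfl, hvc, hvS, u, huS, hu, huv⟩)
    · have hvt : v ≠ t := fun h => hc.2.2.2 (h ▸ huv.symm)
      have hvS : v ∈ S := (hv.resolve_left hvs).resolve_left hvt
      have hvB : ¬ G.Adj v t := hno' a haS v hvS hc hcS hsa hac huv
      have hvc : v ∈ centre G s t := ⟨hvs, hvt, hvA, fun h => hvB h.symm⟩
      exact absurd (hcen hvc).symm huv.ne
  have hmem : ∀ (u v : V) (P : G.Walk u v), u ∈ X →
      (∀ x ∈ P.support, x = s ∨ x = t ∨ x ∈ S) → v ∈ X := by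
    intro u v P
    induction P with
    | nil => exact fun hu _ => hu
    | cons h P ih =>
      intro hu hP
      refine ih (hclosed _ hu _ h (hP _ ?_)) fun x hx => hP x ?_
      · simp
      · simp [hx]
  rcases hmem s t W (Or.inl rfl) hW with h | ⟨_, h⟩ | ⟨h, hc, _⟩
  · exact hst h.symm
  · exact hadj h
  · exact hc.2.1 h.symm

/-- The edges between the neighbours of `s` and the neighbours of `t`. -/
def Bridge (G : SimpleGraph V) (s t u v : V) : Prop :=
  G.Adj u v ∧ ((G.Adj s u ∧ G.Adj v t) ∨ (G.Adj s v ∧ G.Adj u t))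

lemma Bridge.comm {u v : V} (h : Bridge G s t u v) : Bridge G s t v u :=
  ⟨h.1.symm, h.2.symm⟩

lemma Bridge.symm {u v : V} (h : Bridge G s t u v) : Bridge G t s u v :=
  ⟨h.1, h.2.symm.imp (fun h => ⟨h.2.symm, h.1.symm⟩) fun h => ⟨h.2.symm, h.1.symm⟩⟩

lemma Bridge.ne_left {u v : V} (hadj : ¬ G.Adj s t) (h : Bridge G s t u v) : v ≠ s := by
  rintro rfl
  rcases h.2 with h | h
  · exact hadj h.2
  · exact h.1.ne rfl

lemma Bridge.ne_right {u v : V} (hadj : ¬ G.Adj s t) (h : Bridge G s t u v) : v ≠ t :=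
  h.symm.ne_left fun h' => hadj h'.symm

lemma Bridge.notMem_centre {u v : V} (h : Bridge G s t u v) : v ∉ centre G s t := by
  rcases h.2 with h | h
  · exact fun hv => hv.2.2.2 h.2.symm
  · exact fun hv => hv.2.2.1 h.1

lemma centre_symm : centre G t s = centre G s t := by
  ext v
  simp only [centre, Set.mem_ofPred_eq]
  tauto

/-- Cut pairs the ends of each bridge. By `hc`, a path through `c` also contains both ends of a
bridge. -/
lemma not_shortWins_of_bridges {c : V} (hst : s ≠ t) (hadj : ¬ G.Adj s t)
    (hdisj : ∀ v, G.Adj s v → ¬ G.Adj v t) (hcen : centre G s t ⊆ {c})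
    (hfun : ∀ u v w, Bridge G s t u v → Bridge G s t u w → v = w)
    (hc : c ∈ centre G s t → ∀ a b, G.Adj s a → G.Adj a c → G.Adj c b → G.Adj b t → G.Adj a b) :
    ¬ ShortWins G s t .short ∅ ∅ := by
  refine not_shortWins_of_pairing (R := Bridge G s t) (fun u v h => h.comm)
    (fun u h => h.1.ne rfl) hfun (fun u v h => h.ne_left hadj) (fun u v h => h.ne_right hadj)
    fun S hJ => ?_
  rcases hJ.exists_short_path hst hadj hdisj hcen with
    ⟨a, ha, b, hb, hsa, hab, hbt⟩ | ⟨a, ha, b, hb, hcc, -, hsa, hac, hcb, hbt⟩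
  · exact ⟨a, ha, b, hb, hab, Or.inl ⟨hsa, hbt⟩⟩
  · exact ⟨a, ha, b, hb, hc hcc a b hsa hac hcb hbt, Or.inl ⟨hsa, hbt⟩⟩

/-- Neither `x` nor the central vertex `c` lies on a bridge, so adding the pair `{c, x}` keeps the
pairs disjoint. It blocks the paths through both `c` and `x`. -/
lemma not_shortWins_of_bridges_of_pair {c x : V} (hst : s ≠ t) (hadj : ¬ G.Adj s t)
    (hdisj : ∀ v, G.Adj s v → ¬ G.Adj v t) (hcen : centre G s t = {c})
    (hfun : ∀ u v w, Bridge G s t u v → Bridge G s t u w → v = w)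
    (hxs : x ≠ s) (hxt : x ≠ t) (hxc : x ≠ c) (hx : ∀ v, ¬ Bridge G s t x v)
    (hc : ∀ a b, G.Adj s a → G.Adj a c → G.Adj c b → G.Adj b t → G.Adj a b ∨ a = x ∨ b = x) :
    ¬ ShortWins G s t .short ∅ ∅ := by
  have hcc : c ∈ centre G s t := hcen ▸ Set.mem_singleton c
  have hcB : ∀ v, ¬ Bridge G s t c v := fun v h => h.comm.notMem_centre hcc
  refine not_shortWins_of_pairing
    (R := fun u v => Bridge G s t u v ∨ (u = c ∧ v = x) ∨ (u = x ∧ v = c)) ?_ ?_ ?_ ?_ ?_ ?_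
  · rintro u v (h | h | h)
    · exact Or.inl h.comm
    · exact Or.inr (Or.inr h.symm)
    · exact Or.inr (Or.inl h.symm)
  · rintro u (h | ⟨rfl, h⟩ | ⟨rfl, h⟩)
    · exact h.1.ne rfl
    · exact hxc h.symm
    · exact hxc h
  · rintro u v w (h | ⟨rfl, rfl⟩ | ⟨rfl, rfl⟩) (h' | ⟨h', h''⟩ | ⟨h', h''⟩)
    · exact hfun u v w h h'
    · exact absurd (h' ▸ h) (hcB v)
    · exact absurd (h' ▸ h) (hx v)
    · exact absurd h' (hcB w)
    · exact h''.symm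
    · exact absurd h'.symm hxc
    · exact absurd h' (hx w)
    · exact absurd h' hxc
    · exact h''.symm
  · rintro u v (h | ⟨-, rfl⟩ | ⟨-, rfl⟩)
    · exact h.ne_left hadj
    · exact hxs
    · exact hcc.1
  · rintro u v (h | ⟨-, rfl⟩ | ⟨-, rfl⟩)
    · exact h.ne_right hadj
    · exact hxt
    · exact hcc.2.1
  · intro S hJ
    rcases hJ.exists_short_path hst hadj hdisj hcen.subset with
      ⟨a, ha, b, hb, hsa, hab, hbt⟩ | ⟨a, ha, b, hb, -, hcS, hsa, hac, hcb, hbt⟩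
    · exact ⟨a, ha, b, hb, Or.inl ⟨hab, Or.inl ⟨hsa, hbt⟩⟩⟩
    · rcases hc a b hsa hac hcb hbt with hab | rfl | rfl
      · exact ⟨a, ha, b, hb, Or.inl ⟨hab, Or.inl ⟨hsa, hbt⟩⟩⟩
      · exact ⟨c, hcS, a, ha, Or.inr (Or.inl ⟨rfl, rfl⟩)⟩
      · exact ⟨c, hcS, b, hb, Or.inr (Or.inl ⟨rfl, rfl⟩)⟩

/-! ### Small covers of critical graphs -/

section Critical

variable [Finite V]

lemma IsShortCritical.covers_of_common_neighbor (h : IsShortCritical G s t) {v : V}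
    (hsv : G.Adj s v) (hvt : G.Adj v t) : Covers G s t {v} :=
  h.covers (shortWins_of_common_neighbor (v := v) ⟨hsv, by simp, by simp⟩
    ⟨hvt, by simp, by simp⟩)

lemma IsShortCritical.covers_of_cherry [DecidableEq V] (h : IsShortCritical G s t) {a b b' : V}
    (hsa : G.Adj s a) (hab : G.Adj a b) (hab' : G.Adj a b') (hbt : G.Adj b t)
    (hbt' : G.Adj b' t) (hbb : b ≠ b') : Covers G s t {a, b, b'} := by
  refine h.covers (shortWins_of_cherry (a := a) (b := b) (b' := b') (fun hr => h.not_adj hr.1)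
    ⟨hsa, ?_⟩ ⟨hab, ?_⟩ ⟨hab', ?_⟩ ⟨hbt, ?_⟩ ⟨hbt', ?_⟩ ?_ ?_ hbb)
  any_goals simp
  · exact fun hbs => h.not_adj (hbs ▸ hbt)
  · exact fun hbs => h.not_adj (hbs ▸ hbt')

/-- If bridges form a matching, and the only central vertex has at most one neighbour adjacent to
`s`, then a critical graph is covered by five vertices. -/
lemma IsShortCritical.exists_covers_of_subsingleton [DecidableEq V] (h : IsShortCritical G s t)
    {c : V} (hst : s ≠ t) (hdisj : ∀ v, G.Adj s v → ¬ G.Adj v t) (hcen : centre G s t = {c})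
    (hfun : ∀ u v w, Bridge G s t u v → Bridge G s t u w → v = w)
    (hsub : ∀ a a', G.Adj s a → G.Adj a c → G.Adj s a' → G.Adj a' c → a = a') :
    ∃ K : Finset V, K.card ≤ 5 ∧ c ∈ K ∧ Covers G s t K := by
  have hcc : c ∈ centre G s t := hcen ▸ Set.mem_singleton c
  have hadj := h.not_adj
  -- Otherwise no path passes through `c`, and pairing along bridges wins for Cut.
  obtain ⟨a, hsa, hac⟩ : ∃ a, G.Adj s a ∧ G.Adj a c := by
    by_contra! hcon
    exact not_shortWins_of_bridges hst hadj hdisj hcen.subset hfun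
      (fun _ a b hsa hac => absurd hac (hcon a hsa)) h.wins
  -- Otherwise `a` is on no bridge, and Cut can add the pair `{c, a}`.
  obtain ⟨b, hab, hbt⟩ : ∃ b, G.Adj a b ∧ G.Adj b t := by
    by_contra! hcon
    refine not_shortWins_of_bridges_of_pair (x := a) hst hadj hdisj hcen hfun hsa.ne'
      (fun hat => hadj (hat ▸ hsa)) hac.ne (fun v hv => ?_)
      (fun a' b hsa' hac' _ _ => Or.inr (Or.inl (hsub _ _ hsa' hac' hsa hac))) h.wins
    rcases hv.2 with hv' | hv'
    · exact hcon v hv.1 hv'.2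
    · exact hdisj a hsa hv'.2
  -- Otherwise every path through `c` contains the bridge pair `{a, b}`.
  obtain ⟨b', hcb', hbt', hbb'⟩ : ∃ b', G.Adj c b' ∧ G.Adj b' t ∧ b ≠ b' := by
    by_contra! hcon
    refine not_shortWins_of_bridges hst hadj hdisj hcen.subset hfun
      (fun _ a' b' hsa' hac' hcb' hbt' => ?_) h.wins
    rw [hsub _ _ hsa' hac' hsa hac, ← hcon b' hcb' hbt']
    exact hab
  have hcb : c ≠ b := fun e => hcc.2.2.2 (e ▸ hbt.symm)
  by_cases hmatched : ∃ a', G.Adj s a' ∧ G.Adj a' b'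
  · obtain ⟨a', hsa', hab'⟩ := hmatched
    have hca' : c ≠ a' := fun e => hcc.2.2.1 (e ▸ hsa')
    have haa : a ≠ a' := by
      rintro rfl
      exact hbb' (hfun a b b' ⟨hab, Or.inl ⟨hsa, hbt⟩⟩ ⟨hab', Or.inl ⟨hsa, hbt'⟩⟩)
    refine ⟨{a, a', b, b', c}, Finset.card_le_five, by simp, h.covers ?_⟩
    refine shortWins_of_forced_pair (a := a) (a' := a') (b := b) (b' := b') (c := c)
      (fun hr => hadj hr.1) ⟨hsa, ?_⟩ ⟨hsa', ?_⟩ ⟨hab, ?_⟩ ⟨hab', ?_⟩ ⟨hbt, ?_⟩ ⟨hbt', ?_⟩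
      ⟨hac, ?_⟩ ⟨hcb', ?_⟩ hcc.1 hcc.2.1 hcb hca' haa hbb' fun v hv hv' => hdisj v hv.1 hv'.1
    all_goals simp
  · push Not at hmatched
    -- Here `b'` is on no bridge, so Cut could add the pair `{c, b'}` if `b` and `b'` were the only
    -- exits from `c`.
    obtain ⟨b'', hcb'', hbt'', hbb'', hne⟩ :
        ∃ b'', G.Adj c b'' ∧ G.Adj b'' t ∧ b ≠ b'' ∧ b' ≠ b'' := by
      by_contra! hcon
      refine not_shortWins_of_bridges_of_pair (x := b') hst hadj hdisj hcen hfun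
        (fun e => hadj (e ▸ hbt')) hbt'.ne hcb'.ne' (fun v hv => ?_)
        (fun a' b'' hsa' hac' hcb'' hbt'' => ?_) h.wins
      · rcases hv.2 with hv' | hv'
        · exact hdisj b' hv'.1 hbt'
        · exact hmatched v hv'.1 hv.1.symm
      · rw [hsub _ _ hsa' hac' hsa hac]
        by_cases hb : b = b''
        · exact Or.inl (hb ▸ hab)
        · exact Or.inr (Or.inr (hcon b'' hcb'' hbt'' hb).symm)
    refine ⟨{a, b, b', b'', c}, Finset.card_le_five, by simp, h.covers ?_⟩
    refine shortWins_of_forced_fan (a := a) (b := b) (b' := b') (b'' := b'') (c := c)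
      (fun hr => hadj hr.1) ⟨hsa, ?_⟩ ⟨hab, ?_⟩ ⟨hbt, ?_⟩ ⟨hac, ?_⟩ ⟨hcb', ?_⟩ ⟨hcb'', ?_⟩
      ⟨hbt', ?_⟩ ⟨hbt'', ?_⟩ hcc.1 hcc.2.1 hcb hbb' hbb'' hne fun v hv hv' => hdisj v hv.1 hv'.1
    all_goals simp

/-- If bridges form a matching and there is only one central vertex, then a critical graph is
covered by five vertices. -/
lemma IsShortCritical.exists_covers_of_matching [DecidableEq V] (h : IsShortCritical G s t)
    {c : V} (hst : s ≠ t) (hdisj : ∀ v, G.Adj s v → ¬ G.Adj v t) (hcen : centre G s t = {c})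
    (hfun : ∀ u v w, Bridge G s t u v → Bridge G s t u w → v = w) :
    ∃ K : Finset V, K.card ≤ 5 ∧ c ∈ K ∧ Covers G s t K := by
  by_cases hs : ∀ a a', G.Adj s a → G.Adj a c → G.Adj s a' → G.Adj a' c → a = a'
  · exact h.exists_covers_of_subsingleton hst hdisj hcen hfun hs
  by_cases ht : ∀ b b', G.Adj t b → G.Adj b c → G.Adj t b' → G.Adj b' c → b = b'
  · obtain ⟨K, hK, hcK, hcov⟩ := h.symm.exists_covers_of_subsingleton hst.symm
      (fun v hv hv' => hdisj v hv'.symm hv.symm) (centre_symm.trans hcen)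
      (fun u v w hv hw => hfun u v w hv.symm hw.symm) ht
    exact ⟨K, hK, hcK, hcov.symm⟩
  push Not at hs ht
  obtain ⟨a, a', hsa, hac, hsa', hac', haa⟩ := hs
  obtain ⟨b, b', hbt, hbc, hbt', hbc', hbb⟩ := ht
  have hcc : c ∈ centre G s t := hcen ▸ Set.mem_singleton c
  refine ⟨{a, a', b, b', c}, Finset.card_le_five, by simp, h.covers ?_⟩
  refine shortWins_of_double_fan (a := a) (a' := a') (b := b) (b' := b') (c := c)
    (fun hr => h.not_adj hr.1) ⟨hsa, ?_⟩ ⟨hsa', ?_⟩ ⟨hac, ?_⟩ ⟨hac', ?_⟩ ⟨hbc.symm, ?_⟩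
    ⟨hbc'.symm, ?_⟩ ⟨hbt.symm, ?_⟩ ⟨hbt'.symm, ?_⟩ hcc.1 hcc.2.1 haa hbb
    fun v hv hv' => hdisj v hv.1 hv'.1
  all_goals simp

/-- Unless three vertices cover a critical graph, its bridges form a matching. -/
lemma IsShortCritical.bridge_unique (h : IsShortCritical G s t)
    (hthree : ¬ ∃ K : Finset V, K.card ≤ 3 ∧ Covers G s t K) (u v w : V)
    (hv : Bridge G s t u v) (hw : Bridge G s t u w) : v = w := by
  classical
  by_contra hne
  have hdisj : ∀ x, G.Adj s x → ¬ G.Adj x t := fun x hx hx' =>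
    hthree ⟨{x}, by simp, h.covers_of_common_neighbor hx hx'⟩
  rcases hv.2 with hv' | hv' <;> rcases hw.2 with hw' | hw'
  · exact hthree ⟨{u, v, w}, Finset.card_le_three,
      h.covers_of_cherry hv'.1 hv.1 hw.1 hv'.2 hw'.2 hne⟩
  · exact hdisj u hv'.1 hw'.2
  · exact hdisj u hw'.1 hv'.2
  · exact hthree ⟨{u, v, w}, Finset.card_le_three,
      (h.symm.covers_of_cherry hv'.2.symm hv.1 hw.1 hv'.1.symm hw'.1.symm hne).symm⟩

lemma Covers.weight_le {K : Finset V} (h : Covers G s t K) :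
    weight s t ≤ ((K : Set V) ∪ centre G s t).ncard := by
  refine Set.ncard_le_ncard fun v hv => ?_
  by_cases hs : G.Adj s v
  · exact Or.inl ((h v s hs.symm).resolve_right (not_or.mpr hv))
  by_cases ht : G.Adj t v
  · exact Or.inl ((h v t ht.symm).resolve_right (not_or.mpr hv))
  · exact Or.inr ⟨hv.1, hv.2, hs, ht⟩

lemma IsShortCritical.weight_le_three (h : IsShortCritical G s t) (hst : s ≠ t)
    (hcen : (centre G s t).ncard = 0) : weight s t ≤ 3 := by
  classical
  rw [Set.ncard_eq_zero] at hcen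
  by_cases hthree : ∃ K : Finset V, K.card ≤ 3 ∧ Covers G s t K
  · obtain ⟨K, hK, hcov⟩ := hthree
    refine hcov.weight_le.trans ?_
    rwa [hcen, Set.union_empty, Set.ncard_coe_finset]
  -- The centre is empty, so `s` merely fills the place of the central vertex.
  · refine absurd h.wins (not_shortWins_of_bridges (c := s) hst h.not_adj (fun x hx hx' =>
      hthree ⟨{x}, by simp, h.covers_of_common_neighbor hx hx'⟩) (by simp [hcen])
      (h.bridge_unique hthree) (by simp [hcen]))

lemma IsShortCritical.weight_le_five (h : IsShortCritical G s t) (hst : s ≠ t)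
    (hcen : (centre G s t).ncard = 1) : weight s t ≤ 5 := by
  classical
  obtain ⟨c, hc⟩ := Set.ncard_eq_one.mp hcen
  by_cases hthree : ∃ K : Finset V, K.card ≤ 3 ∧ Covers G s t K
  · obtain ⟨K, hK, hcov⟩ := hthree
    have hle := hcov.weight_le.trans (Set.ncard_union_le _ _)
    rw [hcen, Set.ncard_coe_finset] at hle
    omega
  · obtain ⟨K, hK, hcK, hcov⟩ := h.exists_covers_of_matching hst (fun x hx hx' =>
      hthree ⟨{x}, by simp, h.covers_of_common_neighbor hx hx'⟩) hc (h.bridge_unique hthree)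
    refine hcov.weight_le.trans ?_
    rwa [hc, Set.union_eq_left.mpr (by simpa using hcK), Set.ncard_coe_finset]

end Critical

/-! ### Counting degrees -/

lemma weight_eq [Fintype V] [DecidableRel G.Adj] (hadj : ¬ G.Adj s t)
    (hdisj : ∀ v, G.Adj s v → ¬ G.Adj v t) :
    G.degree s + G.degree t + (centre G s t).ncard = weight s t := by
  have hN : Disjoint (G.neighborSet s) (G.neighborSet t) :=
    Set.disjoint_left.mpr fun v hv hv' => hdisj v hv hv'.symm
  have hNc : Disjoint (G.neighborSet s ∪ G.neighborSet t) (centre G s t) := by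
    refine Set.disjoint_left.mpr ?_
    rintro v (hv | hv) hc
    · exact hc.2.2.1 hv
    · exact hc.2.2.2 hv
  have hdeg : ∀ v, G.degree v = (G.neighborSet v).ncard := fun v => by
    rw [← G.card_neighborFinset_eq_degree, ← Set.ncard_coe_finset, G.coe_neighborFinset]
  rw [hdeg, hdeg, ← Set.ncard_union_eq hN, ← Set.ncard_union_eq hNc, weight]
  congr 1
  ext v
  simp only [Set.mem_union, SimpleGraph.mem_neighborSet, centre, Set.mem_ofPred_eq]
  constructor
  · rintro ((hv | hv) | hv)
    · exact ⟨hv.ne', fun e => hadj (e ▸ hv)⟩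
    · exact ⟨fun e => hadj (e ▸ hv).symm, hv.ne'⟩
    · exact ⟨hv.1, hv.2.1⟩
  · tauto

lemma Covers.degree_left_le_one [Fintype V] [DecidableRel G.Adj] {v : V}
    (h : Covers G s t {v}) (hadj : ¬ G.Adj s t) : G.degree s ≤ 1 := by
  rw [← G.card_neighborFinset_eq_degree, ← Finset.card_singleton v]
  refine Finset.card_le_card fun u hu => ?_
  rw [SimpleGraph.mem_neighborFinset] at hu
  rcases h u s hu.symm with h | rfl | rfl
  · exact h
  · exact absurd rfl hu.ne
  · exact absurd hu hadj

end ShannonGame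

theorem mainTheorem2 {V : Type*} [Fintype V] (G : SimpleGraph V) [DecidableRel G.Adj]
    (s t : V) (hst : s ≠ t) (hmin : ShannonGame.IsMinimalWeakLink G s t) :
    (3 < ShannonGame.weight s t → 1 ≤ (ShannonGame.centre G s t).ncard) ∧
    (5 < ShannonGame.weight s t → 2 ≤ (ShannonGame.centre G s t).ncard) ∧
    (ShannonGame.weight s t ≤ 7 →
      (G.degree s : ℚ) + (G.degree t : ℚ) ≤ ((ShannonGame.weight s t : ℚ) + 3) / 2) := by
  classical
  have h := hmin.isShortCritical
  have h0 := h.weight_le_three hst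
  have h1 := h.weight_le_five hst
  refine ⟨fun hw => by omega, fun hw => by omega, fun hw => ?_⟩
  suffices hdeg : 2 * (G.degree s + G.degree t) ≤ ShannonGame.weight s t + 3 by
    rw [le_div_iff₀ two_pos]
    have : ((2 * (G.degree s + G.degree t) : ℕ) : ℚ) ≤ (ShannonGame.weight s t + 3 : ℕ) := by
      exact_mod_cast hdeg
    push_cast at this
    linarith
  by_cases hcommon : ∃ v, G.Adj s v ∧ G.Adj v t
  · obtain ⟨v, hsv, hvt⟩ := hcommon
    have hcov := h.covers_of_common_neighbor hsv hvt
    have hds := hcov.degree_left_le_one h.not_adj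
    have hdt := hcov.symm.degree_left_le_one h.symm.not_adj
    have hpos : 0 < ShannonGame.weight s t :=
      (Set.ncard_pos (Set.toFinite _)).mpr ⟨v, hsv.ne', hvt.ne⟩
    omega
  · push Not at hcommon
    have hw' := ShannonGame.weight_eq h.not_adj hcommon
    -- With `p` the size of the centre, the goal becomes `w ≤ 2p + 3`; `h0`, `h1` and `hw` give it
    -- for `p = 0`, `p = 1` and `p ≥ 2`.
    omega
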